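/- Let $K$ be a field of characteristic zero, let $\alpha\in K$, and put $C=\frac13(x^3+y^3+z^3)-\alpha xyz\in K[x,y,z]$. Let $P_C[x,y,z]$ (the elliptic Poisson algebra) be the polynomial algebra $K[x,y,z]$ with the Poisson bracket $\{f,g\}=J(f,g,C)$, where $J(f_1,f_2,f_3)$ is the determinant of the Jacobian matrix of $f_1,f_2,f_3$ with respect to $x,y,z$; equivalently, $\{x,y\}=z^2-\alpha xy$, $\{y,z\}=x^2-\alpha yz$, $\{z,x\}=y^2-\alpha zx$. Let $0\neq\lambda\in K$. The ideal $(C-\lambda)$ of $K[x,y,z]$ generated by $C-\lambda$ is a Poisson ideal, and the quotient Poisson algebra $S=P_C[x,y,z]/(C-\lambda)$ is central and simple: its center $\{s\in S : \{s,t\}=0 \text{ for all } t\in S\}$ is equal to $K$, and $S\neq 0$ has no ideals $I$ of the commutative algebra $S$ with $\{S,I\}\subseteq I$ other than $0$ and $S$. -/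

import Mathlib

/-- A Poisson bracket on a commutative associative `K`-algebra `A`: a `K`-bilinear Lie bracket
(alternating and satisfying the Jacobi identity) which satisfies the Leibniz identity. A Poisson
algebra over `K` is a commutative `K`-algebra together with such a bracket. -/
structure PoissonBracket (K A : Type*) [CommRing K] [CommRing A] [Algebra K A] where
  /-- the bracket `{a, b}` -/
  br : A →ₗ[K] A →ₗ[K] A
  br_self : ∀ a, br a a = 0
  jacobi : ∀ a b c, br a (br b c) + br b (br c a) + br c (br a b) = 0
  leibniz : ∀ a b c, br a (b * c) = br a b * c + b * br a c

namespace PoissonBracket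

variable {K A : Type*} [CommRing K] [CommRing A] [Algebra K A]

theorem br_skew (P : PoissonBracket K A) (a b : A) : P.br a b = -P.br b a := by
  have h := P.br_self (a + b)
  simp only [map_add, LinearMap.add_apply, P.br_self, zero_add, add_zero] at h
  exact eq_neg_of_add_eq_zero_right h

theorem br_algebraMap (P : PoissonBracket K A) (a : A) (r : K) :
    P.br a (algebraMap K A r) = 0 := by
  have h := P.leibniz a 1 1
  simp only [mul_one, one_mul, left_eq_add] at h
  rw [Algebra.algebraMap_eq_smul_one, map_smul, h, smul_zero]

/-- An ideal `I` of the commutative algebra `A` is a Poisson ideal if `{A, I} ⊆ I`. -/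
def IsPoissonIdeal (P : PoissonBracket K A) (I : Ideal A) : Prop :=
  ∀ a : A, ∀ b ∈ I, P.br a b ∈ I

/-- The (Poisson) center: all `z` with `{z, a} = 0` for every `a`. -/
def center (P : PoissonBracket K A) : Subalgebra K A where
  carrier := {z | ∀ a, P.br z a = 0}
  mul_mem' {x y} hx hy a := by
    rw [P.br_skew, P.leibniz, P.br_skew a x, P.br_skew a y, hx a, hy a]
    simp
  add_mem' {x y} hx hy a := by rw [map_add, LinearMap.add_apply, hx a, hy a, add_zero]
  algebraMap_mem' r a := by rw [P.br_skew, P.br_algebraMap, neg_zero]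

/-- A Poisson algebra over `K` is central if its center is (the image of) `K`. -/
def IsCentral (P : PoissonBracket K A) : Prop :=
  P.center = ⊥

/-- A Poisson algebra is simple if it is nonzero and has no Poisson ideals besides `0` and
the whole algebra. -/
structure IsSimple (P : PoissonBracket K A) : Prop where
  nontrivial : Nontrivial A
  eq_bot_or_eq_top : ∀ I : Ideal A, P.IsPoissonIdeal I → I = ⊥ ∨ I = ⊤

/-- The bracket induced on the quotient by a Poisson ideal, `{a + I, b + I} = {a, b} + I`,
as a function. -/
def quotientFun (P : PoissonBracket K A) (I : Ideal A) (hI : P.IsPoissonIdeal I)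
    (a b : A ⧸ I) : A ⧸ I :=
  Quotient.liftOn₂' a b (fun a b => Ideal.Quotient.mk I (P.br a b)) (by
    intro a₁ b₁ a₂ b₂ ha hb
    rw [Submodule.quotientRel_def] at ha hb
    rw [Ideal.Quotient.eq]
    have h : P.br a₁ b₁ - P.br a₂ b₂ = P.br a₁ (b₁ - b₂) - P.br b₂ (a₁ - a₂) := by
      rw [P.br_skew b₂ (a₁ - a₂)]
      simp only [map_sub, LinearMap.sub_apply]
      ring
    rw [h]
    exact I.sub_mem (hI _ _ hb) (hI _ _ ha))

/-- The quotient Poisson algebra `A / I` of a Poisson algebra by a Poisson ideal. -/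
def quotient (P : PoissonBracket K A) (I : Ideal A) (hI : P.IsPoissonIdeal I) :
    PoissonBracket K (A ⧸ I) where
  br := LinearMap.mk₂ K (P.quotientFun I hI)
    (by
      intro a b c
      obtain ⟨a, rfl⟩ := Ideal.Quotient.mk_surjective a
      obtain ⟨b, rfl⟩ := Ideal.Quotient.mk_surjective b
      obtain ⟨c, rfl⟩ := Ideal.Quotient.mk_surjective c
      change Ideal.Quotient.mk I (P.br (a + b) c)
        = Ideal.Quotient.mk I (P.br a c) + Ideal.Quotient.mk I (P.br b c)
      rw [map_add, LinearMap.add_apply, map_add])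
    (by
      intro r a b
      obtain ⟨a, rfl⟩ := Ideal.Quotient.mk_surjective a
      obtain ⟨b, rfl⟩ := Ideal.Quotient.mk_surjective b
      change Ideal.Quotient.mk I (P.br (r • a) b) = Ideal.Quotient.mk I (r • P.br a b)
      rw [map_smul, LinearMap.smul_apply])
    (by
      intro a b c
      obtain ⟨a, rfl⟩ := Ideal.Quotient.mk_surjective a
      obtain ⟨b, rfl⟩ := Ideal.Quotient.mk_surjective b
      obtain ⟨c, rfl⟩ := Ideal.Quotient.mk_surjective c
      change Ideal.Quotient.mk I (P.br a (b + c))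
        = Ideal.Quotient.mk I (P.br a b) + Ideal.Quotient.mk I (P.br a c)
      rw [map_add, map_add])
    (by
      intro r a b
      obtain ⟨a, rfl⟩ := Ideal.Quotient.mk_surjective a
      obtain ⟨b, rfl⟩ := Ideal.Quotient.mk_surjective b
      change Ideal.Quotient.mk I (P.br a (r • b)) = Ideal.Quotient.mk I (r • P.br a b)
      rw [map_smul])
  br_self a := by
    obtain ⟨a, rfl⟩ := Ideal.Quotient.mk_surjective a
    change Ideal.Quotient.mk I (P.br a a) = 0
    rw [P.br_self, map_zero]
  jacobi a b c := by
    obtain ⟨a, rfl⟩ := Ideal.Quotient.mk_surjective a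
    obtain ⟨b, rfl⟩ := Ideal.Quotient.mk_surjective b
    obtain ⟨c, rfl⟩ := Ideal.Quotient.mk_surjective c
    change Ideal.Quotient.mk I (P.br a (P.br b c)) + Ideal.Quotient.mk I (P.br b (P.br c a))
      + Ideal.Quotient.mk I (P.br c (P.br a b)) = 0
    rw [← map_add, ← map_add, P.jacobi, map_zero]
  leibniz a b c := by
    obtain ⟨a, rfl⟩ := Ideal.Quotient.mk_surjective a
    obtain ⟨b, rfl⟩ := Ideal.Quotient.mk_surjective b
    obtain ⟨c, rfl⟩ := Ideal.Quotient.mk_surjective c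
    change Ideal.Quotient.mk I (P.br a (b * c)) = Ideal.Quotient.mk I (P.br a b)
      * Ideal.Quotient.mk I c + Ideal.Quotient.mk I b * Ideal.Quotient.mk I (P.br a c)
    rw [P.leibniz, map_add, map_mul, map_mul]

end PoissonBracket

section Jacobian

variable {K : Type*} [CommRing K]

/-- The Jacobian `J(f₀, f₁, f₂) = det (∂fᵢ/∂xⱼ)` in `K[x, y, z]`, where `x, y, z` are the variables
`X 0, X 1, X 2`. -/
noncomputable def jacobian (f : Fin 3 → MvPolynomial (Fin 3) K) : MvPolynomial (Fin 3) K :=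
  Matrix.det (Matrix.of fun i j => MvPolynomial.pderiv j (f i))

theorem pderiv_pderiv_comm (i j : Fin 3) (f : MvPolynomial (Fin 3) K) :
    MvPolynomial.pderiv i (MvPolynomial.pderiv j f)
      = MvPolynomial.pderiv j (MvPolynomial.pderiv i f) := by
  have h : ⁅MvPolynomial.pderiv (R := K) i, MvPolynomial.pderiv (R := K) j⁆ = 0 := by
    apply MvPolynomial.derivation_ext
    intro k
    simp [Derivation.commutator_apply, MvPolynomial.pderiv_X, Pi.single_apply, apply_ite]
  have h' := congrArg (fun D => D f) h
  simpa [Derivation.commutator_apply, sub_eq_zero] using h'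

/-- The Poisson algebra `P_C[x, y, z]`: the polynomial algebra `K[x, y, z]` with the bracket
`{f, g} = J(f, g, C)`. -/
noncomputable def jacobianPoisson (C : MvPolynomial (Fin 3) K) :
    PoissonBracket K (MvPolynomial (Fin 3) K) where
  br := LinearMap.mk₂ K (fun f g => jacobian ![f, g, C])
    (by intro f g h; simp [jacobian, Matrix.det_fin_three]; ring)
    (by intro r f g; simp [jacobian, Matrix.det_fin_three, MvPolynomial.smul_eq_C_mul]; ring)
    (by intro f g h; simp [jacobian, Matrix.det_fin_three]; ring)
    (by intro r f g; simp [jacobian, Matrix.det_fin_three, MvPolynomial.smul_eq_C_mul]; ring)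
  br_self f := by simp [jacobian, Matrix.det_fin_three]; ring
  jacobi f g h := by
    simp [jacobian, Matrix.det_fin_three]
    simp only [pderiv_pderiv_comm 1 0, pderiv_pderiv_comm 2 0, pderiv_pderiv_comm 2 1]
    ring
  leibniz f g h := by simp [jacobian, Matrix.det_fin_three]; ring

/-- For a constant `c`, the ideal generated by `C - c` is a Poisson ideal of `P_C[x, y, z]`. -/
theorem isPoissonIdeal_span_sub (C : MvPolynomial (Fin 3) K) (c : K) :
    (jacobianPoisson C).IsPoissonIdeal (Ideal.span {C - MvPolynomial.C c}) := by
  intro a b hb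
  obtain ⟨d, rfl⟩ := Ideal.mem_span_singleton'.1 hb
  have h : (jacobianPoisson C).br a (C - MvPolynomial.C c) = 0 := by
    simp [jacobianPoisson, jacobian, Matrix.det_fin_three]
    ring
  rw [PoissonBracket.leibniz, h, mul_zero, add_zero]
  exact Ideal.mul_mem_left _ _ (Ideal.mem_span_singleton_self _)

/-- The quotient Poisson algebra `P_C[x, y, z] / (C - c)`. -/
noncomputable def jacobianPoissonQuotient (C : MvPolynomial (Fin 3) K) (c : K) :
    PoissonBracket K (MvPolynomial (Fin 3) K ⧸ Ideal.span {C - MvPolynomial.C c}) :=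
  (jacobianPoisson C).quotient (Ideal.span {C - MvPolynomial.C c}) (isPoissonIdeal_span_sub C c)

end Jacobian

/-- The polynomial `(1/3)(x³ + y³ + z³) - α x y z`, the standard Casimir element of the elliptic
Poisson algebra with parameter `α`. -/
noncomputable def ellipticCasimir {K : Type*} [Field K] (α : K) : MvPolynomial (Fin 3) K :=
  MvPolynomial.C (1 / 3)
      * (MvPolynomial.X 0 ^ 3 + MvPolynomial.X 1 ^ 3 + MvPolynomial.X 2 ^ 3)
    - MvPolynomial.C α * (MvPolynomial.X 0 * MvPolynomial.X 1 * MvPolynomial.X 2)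

/-! The relation `C = c` is monic cubic in `z`, so `S` is free over `K[x,y]` with basis `1, z, z²`.
It is also a domain, since the cubic is irreducible for `c ≠ 0`.

Center: write `s = p + qz + rz²`. Then `{x, s} = 0` becomes a linear differential system in `y`, and
comparing top degrees forces `q = r = 0` and `∂p/∂y = 0`. Now `{y, s} = 0` makes `s` constant
(`isCentral`).

Simplicity: the radical of a nonzero Poisson ideal is again Poisson, and by integrality it contains
a nonzero `p(x,y)`. Bracketing with `x` and `y` differentiates `p` down to a constant and leaves `w
= {x,y} = ∂C/∂z` in the radical (`gradient_mem_of_evalXY_mem`). Further brackets give the other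
partial derivatives of `C`, and Euler's identity `x C_x + y C_y + z C_z = 3C = 3c` then yields a
unit (`eq_top_of_gradient_mem`). Thus smoothness of the surface is what excludes Poisson ideals. -/

namespace PoissonBracket

/-! ### Radicals of Poisson ideals. -/

variable {K A : Type*} [CommRing K] [CommRing A] [Algebra K A]

/-- The Hamiltonian derivation `{a, ·}`. -/
def hamiltonian (P : PoissonBracket K A) (a : A) : Derivation K A A :=
  Derivation.mk' (P.br a) fun b c => by
    rw [P.leibniz, smul_eq_mul, smul_eq_mul]; ring

theorem hamiltonian_apply (P : PoissonBracket K A) (a b : A) : P.hamiltonian a b = P.br a b := rfl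

/-- In characteristic zero, the radical of an ideal stable under a derivation is stable. -/
theorem _root_.Derivation.mem_radical_of_stable {K A : Type*} [Field K] [CharZero K] [CommRing A]
    [Algebra K A] (D : Derivation K A A) {I : Ideal A} (hI : ∀ b ∈ I, D b ∈ I) {a : A}
    (ha : a ∈ I.radical) : D a ∈ I.radical := by
  obtain ⟨n, hn⟩ := ha
  -- Each application of `D` trades one factor `a` for two factors `D a`; starting from `a ^ n`,
  -- this ends at `(D a) ^ (2n)`.
  have key : ∀ k j, k + j = n → a ^ j * D a ^ (2 * k) ∈ I := by
    intro k
    induction k with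
    | zero => intro j hj; simpa [← hj] using hn
    | succ k ih =>
      intro j hj
      have h := ih (j + 1) (by omega)
      have h1 := I.mul_mem_right (D a) (hI _ h)
      have h2 : ((j : K) + 1) • (a ^ j * D a ^ (2 * (k + 1))) ∈ I := by
        have e : ((j : K) + 1) • (a ^ j * D a ^ (2 * (k + 1)))
            = D (a ^ (j + 1) * D a ^ (2 * k)) * D a
              - (a ^ (j + 1) * D a ^ (2 * k)) * ((2 * k : ℕ) * D (D a)) := by
          rw [Derivation.leibniz, Derivation.leibniz_pow, Derivation.leibniz_pow, Algebra.smul_def]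
          simp only [smul_eq_mul, nsmul_eq_mul, map_add, map_natCast, map_one]
          rcases k with _ | k
          · simp; ring
          · have : 2 * (k + 1) - 1 = 2 * k + 1 := by omega
            rw [this]
            push_cast
            ring
        rw [e]
        exact I.sub_mem h1 (I.mul_mem_right _ h)
      have h3 : ((j : K) + 1) ≠ 0 := by exact_mod_cast Nat.succ_ne_zero j
      have h4 := I.mul_mem_left (algebraMap K A ((j : K) + 1)⁻¹) h2
      rwa [Algebra.smul_def, ← mul_assoc, ← map_mul, inv_mul_cancel₀ h3, map_one, one_mul] at h4
  exact ⟨2 * n, by simpa using key n 0 (by simp)⟩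

theorem IsPoissonIdeal.radical {K A : Type*} [Field K] [CharZero K] [CommRing A] [Algebra K A]
    {P : PoissonBracket K A} {I : Ideal A} (hI : P.IsPoissonIdeal I) :
    P.IsPoissonIdeal I.radical :=
  fun a _ hb => (P.hamiltonian a).mem_radical_of_stable (hI a) hb

end PoissonBracket

/-! ### The differential system for the center, and irreducibility of the cubic. -/

namespace Polynomial

theorem coeff_natDegree_add_two_cubic {R : Type*} [CommRing R] (n : R) (k : ℕ) (f : R[X]) :
    ((X ^ 3 + C n) * derivative f + (k : R[X]) * (X ^ 2 * f)).coeff (f.natDegree + 2)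
      = ((f.natDegree + k : ℕ) : R) * f.leadingCoeff := by
  have h0 : (derivative f).coeff (f.natDegree + 2) = 0 := by
    rw [coeff_derivative, coeff_eq_zero_of_natDegree_lt (by omega), zero_mul]
  rw [add_mul, coeff_add, coeff_add, coeff_C_mul, h0, ← C_eq_natCast, coeff_C_mul, coeff_X_pow_mul]
  rcases hd : f.natDegree with _ | d
  · have : derivative f = 0 := by
      rw [eq_C_of_natDegree_eq_zero hd, derivative_C]
    simp [this, leadingCoeff, hd]
  · rw [show d + 1 + 2 = d + 3 by ring, coeff_X_pow_mul, coeff_derivative, leadingCoeff, hd]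
    push_cast
    ring

/-- The linear system satisfied by the coordinates of a constant of `{x, ·}` has only the zero
solution. -/
theorem eq_zero_of_cubic_system {R : Type*} [CommRing R] [IsDomain R] [CharZero R] (n a b : R)
    (q r : R[X])
    (h1 : (X ^ 3 + C n) * derivative q + X ^ 2 * q = C b * (X * (X * derivative r + r)))
    (h2 : (X ^ 3 + C n) * derivative r + 2 * (X ^ 2 * r) = C a * (2 * (X * derivative q) + q)) :
    q = 0 ∧ r = 0 := by
  have h1' := coeff_natDegree_add_two_cubic n 1 q
  have h2' := coeff_natDegree_add_two_cubic n 2 r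
  rw [Nat.cast_one, one_mul, h1, coeff_C_mul, coeff_X_mul, coeff_add, coeff_X_mul,
    coeff_derivative] at h1'
  rw [Nat.cast_ofNat, h2] at h2'
  -- If `r ≠ 0`, the coefficient of `h2` in degree `deg r + 2` forces `deg q ≥ deg r + 2`. Then the
  -- right side of `h1` vanishes in degree `deg q + 2`, while the left side there is `(deg q + 1)`
  -- times the leading coefficient of `q`.
  have hr : r = 0 := by
    by_contra hr
    have hq : q.coeff (r.natDegree + 2) ≠ 0 := by
      intro h0
      rw [coeff_C_mul, coeff_add, show r.natDegree + 2 = r.natDegree + 1 + 1 by ring, coeff_ofNat_mul,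
        coeff_X_mul, coeff_derivative, show r.natDegree + 1 + 1 = r.natDegree + 2 by ring, h0] at h2'
      simp only [zero_mul, mul_zero, add_zero] at h2'
      rcases mul_eq_zero.1 h2'.symm with h | h
      · exact absurd (Nat.cast_eq_zero.1 h) (by omega)
      · exact hr (leadingCoeff_eq_zero.1 h)
    have hle := le_natDegree_of_ne_zero hq
    rw [coeff_eq_zero_of_natDegree_lt (by omega : r.natDegree < q.natDegree + 1)] at h1'
    simp only [zero_mul, mul_zero, add_zero] at h1'
    rcases mul_eq_zero.1 h1'.symm with h | h
    · exact absurd (Nat.cast_eq_zero.1 h) (by omega)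
    · rw [leadingCoeff_eq_zero.1 h] at hq
      simp at hq
  refine ⟨?_, hr⟩
  simp only [hr, coeff_zero, zero_mul, mul_zero, add_zero] at h1'
  rcases mul_eq_zero.1 h1'.symm with h | h
  · exact absurd (Nat.cast_eq_zero.1 h) (by omega)
  · exact leadingCoeff_eq_zero.1 h

/-- Differentiating an equality gives `h² h' = -X²`. As `h(0)³ = e ≠ 0`, `h` is coprime to `X²` yet
divides it, so `h` is constant and `X² = 0`. -/
theorem cube_add_X_pow_ne_C {K : Type*} [Field K] [CharZero K] {e : K} (he : e ≠ 0) (h : K[X]) :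
    h ^ 3 + X ^ 3 ≠ C e := by
  intro hh
  have hd := congrArg derivative hh
  simp only [derivative_add, derivative_pow, derivative_X, derivative_C] at hd
  have hd' : h ^ 2 * derivative h = - X ^ 2 := by
    have h3 : (3 : K[X]) ≠ 0 := by exact_mod_cast (by norm_num : (3 : ℕ) ≠ 0)
    apply mul_left_cancel₀ h3
    simp only [Nat.cast_ofNat, map_ofNat] at hd
    norm_num at hd
    linear_combination hd
  have hX : ¬ (X : K[X]) ∣ h := by
    intro hX
    have h0 : h.eval 0 = 0 := by rwa [X_dvd_iff, coeff_zero_eq_eval_zero] at hX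
    have := congrArg (eval 0) hh
    simp [h0] at this
    exact he this.symm
  have hu : IsUnit h := by
    have hcop : IsCoprime h (X ^ 2) :=
      IsCoprime.pow_right ((irreducible_X.coprime_iff_not_dvd).2 hX).symm
    refine hcop.isUnit_of_dvd' dvd_rfl ?_
    rw [← dvd_neg, ← hd', pow_two, mul_assoc]
    exact dvd_mul_right _ _
  obtain ⟨u, -, rfl⟩ := isUnit_iff.1 hu
  simp at hd'

/-- The polynomial `z³ - 3αxyz + x³ + y³ - 3c` over `K[x][y]`. -/
noncomputable def ellipticCubic {K : Type*} [Field K] (α c : K) : K[X][X][X] :=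
  X ^ 3 + (C (C (C (-3 * α) * X) * X) * X + C (X ^ 3 + C (X ^ 3 - C (3 * c))))

theorem eval₂_ellipticCubic {K A : Type*} [Field K] [CommRing A] (α c : K) (f : K[X][X] →+* A)
    (z : A) : (ellipticCubic α c).eval₂ f z = z ^ 3 - 3 * f (C (C α)) * f (C X) * f X * z
      + f X ^ 3 + f (C X) ^ 3 - 3 * f (C (C c)) := by
  simp only [ellipticCubic, eval₂_add, eval₂_mul, eval₂_pow, eval₂_X, eval₂_C]
  simp only [map_add, map_sub, map_mul, map_pow, map_neg, map_ofNat]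
  ring

theorem ellipticCubic_lower_degree {K : Type*} [Field K] (α c : K) :
    degree (C (C (C (-3 * α) * X) * X) * X + C (X ^ 3 + C (X ^ 3 - C (3 * c))) : K[X][X][X]) < 3 :=
  lt_of_le_of_lt degree_linear_le (by norm_num)

theorem ellipticCubic_monic {K : Type*} [Field K] (α c : K) : (ellipticCubic α c).Monic :=
  monic_X_pow_add (by simpa using ellipticCubic_lower_degree α c)

theorem ellipticCubic_degree {K : Type*} [Field K] (α c : K) : (ellipticCubic α c).degree = 3 := by
  rw [ellipticCubic, degree_add_eq_left_of_degree_lt] <;> rw [degree_X_pow]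
  exacts [rfl, ellipticCubic_lower_degree α c]

/-- Setting `y = 0` leaves the monic cubic `z³ + x³ - 3c` over `K[x]`, which is irreducible because
it has no root there. -/
theorem ellipticCubic_irreducible {K : Type*} [Field K] [CharZero K] {α c : K} (hc : c ≠ 0) :
    Irreducible (ellipticCubic α c) := by
  have hm := ellipticCubic_monic α c
  refine hm.irreducible_of_irreducible_map (evalRingHom (0 : K[X])) _ ?_
  have hdeg : ((ellipticCubic α c).map (evalRingHom (0 : K[X]))).natDegree = 3 := by
    rw [hm.natDegree_map, natDegree_eq_of_degree_eq_some (ellipticCubic_degree α c)]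
  rw [(hm.map _).irreducible_iff_roots_eq_zero_of_degree_le_three (by omega) (by omega),
    Multiset.eq_zero_iff_forall_notMem]
  intro h hh
  have := (mem_roots'.1 hh).2
  rw [IsRoot.def] at this
  simp only [ellipticCubic, Polynomial.map_add, Polynomial.map_mul, Polynomial.map_pow, map_X,
    map_C, coe_evalRingHom, eval_add, eval_mul, eval_pow, eval_X, eval_C, mul_zero, zero_mul,
    zero_add, ne_eq, OfNat.ofNat_ne_zero, not_false_eq_true, zero_pow] at this
  refine cube_add_X_pow_ne_C (mul_ne_zero three_ne_zero hc : 3 * c ≠ 0) h ?_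
  linear_combination this

theorem eq_zero_of_ellipticCubic_dvd {K : Type*} [Field K] {α c : K} {p q r : K[X][X]}
    (h : ellipticCubic α c ∣ C r * X ^ 2 + C q * X + C p) : p = 0 ∧ q = 0 ∧ r = 0 := by
  have h0 := eq_zero_of_dvd_of_degree_lt h
    (by rw [ellipticCubic_degree]; exact lt_of_le_of_lt degree_quadratic_le (by norm_num))
  have hk := fun k => congrArg (fun f => coeff f k) h0
  refine ⟨by simpa using hk 0, by simpa [coeff_X, coeff_C] using hk 1,
    by simpa [coeff_X, coeff_C] using hk 2⟩

end Polynomial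

/-! ### Center and Poisson ideals, from the basis `1, z, z²` over `K[x][y]`. -/

open Polynomial

/-- A Poisson algebra generated by `x, y, z` with the brackets and the relation of the level set
`C = c` of the elliptic Casimir, which is free over `K[x][y]` with basis `1, z, z²`. -/
structure IsEllipticLevel {K S : Type*} [Field K] [CommRing S] [Algebra K S]
    (P : PoissonBracket K S) (α c : K) (x y z : S) : Prop where
  br_xy : P.br x y = z ^ 2 - algebraMap K S α * (x * y)
  br_yz : P.br y z = x ^ 2 - algebraMap K S α * (y * z)
  br_zx : P.br z x = y ^ 2 - algebraMap K S α * (z * x)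
  cube : z ^ 3 = 3 * algebraMap K S α * x * y * z - x ^ 3 - y ^ 3 + 3 * algebraMap K S c
  exists_coords : ∀ s : S, ∃ p q r : K[X][X],
    s = p.eval₂ (aeval x : K[X] →ₐ[K] S) y + q.eval₂ (aeval x : K[X] →ₐ[K] S) y * z
      + r.eval₂ (aeval x : K[X] →ₐ[K] S) y * z ^ 2
  coords_eq_zero : ∀ p q r : K[X][X],
    p.eval₂ (aeval x : K[X] →ₐ[K] S) y + q.eval₂ (aeval x : K[X] →ₐ[K] S) y * z
      + r.eval₂ (aeval x : K[X] →ₐ[K] S) y * z ^ 2 = 0 → p = 0 ∧ q = 0 ∧ r = 0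

namespace IsEllipticLevel

variable {K S : Type*} [Field K] [CommRing S] [Algebra K S]

/-- Evaluation of a polynomial in `K[x][y]`. -/
noncomputable def evalXY (x y : S) : K[X][X] →+* S :=
  eval₂RingHom ((aeval x : K[X] →ₐ[K] S) : K[X] →+* S) y

@[simp] theorem evalXY_X (x y : S) : evalXY (K := K) x y X = y := by simp [evalXY]

@[simp] theorem evalXY_C (x y : S) (f : K[X]) : evalXY (K := K) x y (C f) = aeval x f := by
  simp [evalXY]

theorem derivation_evalXY (D : Derivation K S S) (x y : S) (hx : D x = 0) (p : K[X][X]) :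
    D (evalXY x y p) = evalXY x y (derivative p) * D y := by
  have hf : ∀ f : K[X], D (aeval x f) = 0 := fun f => by
    rw [Derivation.map_aeval, hx, smul_zero]
  induction p using Polynomial.induction_on' with
  | add p q hp hq => simp only [map_add, hp, hq, add_mul]
  | monomial n f =>
    rw [← C_mul_X_pow_eq_monomial, derivative_C_mul_X_pow]
    simp only [map_mul, map_pow, evalXY_C, evalXY_X, Derivation.leibniz, Derivation.leibniz_pow, hf,
      smul_eq_mul, nsmul_eq_mul, mul_zero, add_zero, map_natCast]
    ring

variable {P : PoissonBracket K S} {α c : K} {x y z : S} (h : IsEllipticLevel P α c x y z)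

include h

theorem evalXY_coords (s : S) :
    ∃ p q r : K[X][X], s = evalXY x y p + evalXY x y q * z + evalXY x y r * z ^ 2 :=
  h.exists_coords s

theorem evalXY_eq_zero {p q r : K[X][X]}
    (h0 : evalXY x y p + evalXY x y q * z + evalXY x y r * z ^ 2 = 0) :
    p = 0 ∧ q = 0 ∧ r = 0 :=
  h.coords_eq_zero p q r h0

theorem br_x_evalXY (p : K[X][X]) :
    P.br x (evalXY x y p)
      = evalXY x y (derivative p) * (z ^ 2 - algebraMap K S α * (x * y)) := by
  rw [← P.hamiltonian_apply, derivation_evalXY _ x y (P.br_self x), P.hamiltonian_apply, h.br_xy]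

theorem br_y_aeval (f : K[X]) :
    P.br y (aeval x f)
      = -(aeval x (derivative f) * (z ^ 2 - algebraMap K S α * (x * y))) := by
  rw [← P.hamiltonian_apply, Derivation.map_aeval, P.hamiltonian_apply, P.br_skew, h.br_xy,
    smul_eq_mul]
  ring

theorem isCentral [CharZero K] : P.IsCentral := by
  refine le_antisymm (fun s hs => ?_) bot_le
  have hs' : ∀ a, P.br a s = 0 := fun a => by rw [P.br_skew, hs a, neg_zero]
  obtain ⟨p, q, r, rfl⟩ := h.evalXY_coords s
  have hxz : P.br x z = -(y ^ 2 - algebraMap K S α * (z * x)) := by rw [P.br_skew, h.br_zx]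
  have hx := hs' x
  rw [map_add, map_add, pow_two, P.leibniz, P.leibniz, P.leibniz, h.br_x_evalXY, h.br_x_evalXY,
    h.br_x_evalXY, hxz] at hx
  -- These are the coordinates of `{x, s}` after `z³` is eliminated.
  have hsys := h.evalXY_eq_zero
    (p := -((X ^ 3 + C (X ^ 3 - C (3 * c))) * derivative q
      + C (C α * X) * X * derivative p + X ^ 2 * q))
    (q := C (2 * C α * X) * X * derivative q
      - (X ^ 3 + C (X ^ 3 - C (3 * c))) * derivative r - 2 * (X ^ 2 * r) + C (C α * X) * q)
    (r := derivative p + C (2 * C α * X) * X * derivative r + C (2 * C α * X) * r) (by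
      simp only [map_add, map_sub, map_neg, map_mul, map_pow, evalXY_X, evalXY_C, aeval_X,
        aeval_C, map_ofNat]
      linear_combination hx - (evalXY x y (derivative q) + evalXY x y (derivative r) * z) * h.cube)
  obtain ⟨e1, e2, e3⟩ := hsys
  -- Eliminating `derivative p` from `e1` by means of `e3` produces the coefficient `2(αx)²`.
  obtain ⟨rfl, rfl⟩ := eq_zero_of_cubic_system (X ^ 3 - C (3 * c)) (C α * X)
    (2 * (C α * X) ^ 2) q r
    (by
      simp only [map_mul, map_pow, map_ofNat] at e1 e3 ⊢
      linear_combination -e1 - C (C α) * C X * X * e3)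
    (by
      simp only [map_mul, map_ofNat] at e2 ⊢
      linear_combination -e2)
  simp only [map_zero, mul_zero, add_zero] at e3
  rw [derivative_eq_zero.1 e3 |> eq_C_of_natDegree_eq_zero] at hs' ⊢
  generalize p.coeff 0 = f at hs' ⊢
  have hy := hs' y
  simp only [map_zero, zero_mul, add_zero, evalXY_C] at hy
  rw [h.br_y_aeval] at hy
  have hf := (h.evalXY_eq_zero (p := C (C α * X) * X * C (derivative f)) (q := 0)
    (r := -C (derivative f)) (by
      simp only [map_neg, map_mul, evalXY_X, evalXY_C, aeval_X, aeval_C, map_zero]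
      linear_combination hy)).2.2
  rw [neg_eq_zero, C_eq_zero] at hf
  rw [derivative_eq_zero.1 hf |> eq_C_of_natDegree_eq_zero]
  simp only [map_zero, zero_mul, add_zero, evalXY_C, aeval_C]
  exact Subalgebra.algebraMap_mem _ _

theorem gradient_mem_of_evalXY_mem [CharZero K] {J : Ideal S} (hJ : P.IsPoissonIdeal J)
    (hrad : J.IsRadical) {p : K[X][X]} (hp : p ≠ 0) (hpJ : evalXY x y p ∈ J) :
    z ^ 2 - algebraMap K S α * (x * y) ∈ J := by
  set w := z ^ 2 - algebraMap K S α * (x * y) with hw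
  -- Multiplying `{a, gw} = vw² + g{a,w}` by `w` puts `vw³` in `J`, and `J` is radical. The factor
  -- `w` is carried along so that this can be iterated.
  have step : ∀ a g v, g * w ∈ J → P.br a g = v * w → v * w ∈ J := by
    intro a g v hg hv
    apply hrad
    refine ⟨3, ?_⟩
    have h1 := hJ a _ hg
    rw [P.leibniz, hv] at h1
    have h2 : (v * w) ^ 3 = v ^ 2 * ((v * w * w + g * P.br a w) * w - (g * w) * P.br a w) := by ring
    rw [h2]
    exact J.mul_mem_left _ (J.sub_mem (J.mul_mem_right _ h1) (J.mul_mem_right _ hg))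
  have hconst : ∀ n (f : K[X]), f.natDegree = n → f ≠ 0 → aeval x f * w ∈ J → w ∈ J := by
    intro n
    induction n with
    | zero =>
      intro f hn hf hfJ
      rw [eq_C_of_natDegree_eq_zero hn] at hf hfJ
      rw [aeval_C] at hfJ
      have := J.mul_mem_left (algebraMap K S (f.coeff 0)⁻¹) hfJ
      rwa [← mul_assoc, ← map_mul, inv_mul_cancel₀ (by simpa using hf), map_one, one_mul] at this
    | succ n ih =>
      intro f hn hf hfJ
      have hd : (derivative f).natDegree = n := by rw [natDegree_derivative, hn]; rfl
      refine ih (derivative f) hd ?_ ?_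
      · intro h0
        rw [derivative_eq_zero.1 h0] at hn
        omega
      · have := step y _ (-(aeval x (derivative f))) hfJ (by rw [h.br_y_aeval, neg_mul])
        rw [neg_mul] at this
        exact J.neg_mem_iff.1 this
  have hmain : ∀ n (p : K[X][X]), p.natDegree = n → p ≠ 0 → evalXY x y p * w ∈ J → w ∈ J := by
    intro n
    induction n with
    | zero =>
      intro f hn hf hfJ
      rw [eq_C_of_natDegree_eq_zero hn] at hf hfJ
      rw [evalXY_C] at hfJ
      exact hconst _ _ rfl (by simpa using hf) hfJ
    | succ n ih =>
      intro f hn hf hfJ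
      have hd : (derivative f).natDegree = n := by rw [natDegree_derivative, hn]; rfl
      refine ih (derivative f) hd ?_ (step x _ _ hfJ (h.br_x_evalXY f))
      intro h0
      rw [derivative_eq_zero.1 h0] at hn
      omega
  exact hmain _ p rfl hp (J.mul_mem_right _ hpJ)

theorem eq_top_of_gradient_mem [CharZero K] (hc : c ≠ 0) {J : Ideal S} (hJ : P.IsPoissonIdeal J)
    (hw : z ^ 2 - algebraMap K S α * (x * y) ∈ J) : J = ⊤ := by
  have hunit : ∀ k : K, k ≠ 0 → ∀ s, algebraMap K S k * s ∈ J → s ∈ J := by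
    intro k hk s hs
    have := J.mul_mem_left (algebraMap K S k⁻¹) hs
    rwa [← mul_assoc, ← map_mul, inv_mul_cancel₀ hk, map_one, one_mul] at this
  have hbr : ∀ a, P.br a (z ^ 2 - algebraMap K S α * (x * y))
      = 2 * (z * P.br a z) - algebraMap K S α * (P.br a x * y + x * P.br a y) := by
    intro a
    rw [map_sub, pow_two, P.leibniz, P.leibniz, P.leibniz, P.br_algebraMap]
    ring
  -- With `w = {x,y}`, one has `{x, w} = -2z(y² - αzx) - αxw`; `hzx` is the same computation with
  -- `{y, w}`.
  have hzy : z * (y ^ 2 - algebraMap K S α * (z * x)) ∈ J := by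
    apply hunit 2 two_ne_zero
    have h1 := hJ x _ hw
    rw [hbr, P.br_self, P.br_skew x z, h.br_zx, h.br_xy] at h1
    have e := J.add_mem h1 (J.mul_mem_left (algebraMap K S α * x) hw)
    rw [map_ofNat, ← neg_mem_iff]
    convert e using 1
    ring
  have hzx : z * (x ^ 2 - algebraMap K S α * (y * z)) ∈ J := by
    apply hunit 2 two_ne_zero
    have h1 := hJ y _ hw
    rw [hbr, P.br_self, P.br_skew y x, h.br_yz, h.br_xy] at h1
    have e := J.sub_mem h1 (J.mul_mem_left (algebraMap K S α * y) hw)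
    rw [map_ofNat]
    convert e using 1
    ring
  -- This is Euler's identity multiplied by `z`; the identity itself is used at the end, once `z ∈
  -- J` puts `{y,z}` and `{z,x}` in `J`.
  have hz : z ∈ J := by
    apply hunit (3 * c) (mul_ne_zero three_ne_zero hc)
    have e := J.add_mem (J.add_mem (J.mul_mem_left x hzx) (J.mul_mem_left y hzy))
      (J.mul_mem_left (z * z) hw)
    convert e using 1
    rw [map_mul, map_ofNat]
    linear_combination -z * h.cube
  have hx := hJ y z hz
  have hy := J.neg_mem (hJ x z hz)
  rw [h.br_yz] at hx
  rw [P.br_skew, neg_neg, h.br_zx] at hy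
  rw [Ideal.eq_top_iff_one]
  apply hunit (3 * c) (mul_ne_zero three_ne_zero hc)
  have e := J.add_mem (J.add_mem (J.mul_mem_left x hx) (J.mul_mem_left y hy)) (J.mul_mem_left z hw)
  convert e using 1
  rw [map_mul, map_ofNat]
  linear_combination -h.cube

/-- `S` is integral over `K[x][y]`, so a nonzero `s ∈ I` satisfies a monic equation; in a domain,
powers of `s` cancel until a nonzero coefficient lies in `I`. -/
theorem exists_evalXY_mem [IsDomain S] {I : Ideal S} (hI : I ≠ ⊥) :
    ∃ p : K[X][X], p ≠ 0 ∧ evalXY x y p ∈ I := by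
  let := (evalXY (K := K) x y).toAlgebra
  have hz : IsIntegral K[X][X] z := by
    refine ⟨ellipticCubic α c, ellipticCubic_monic α c, ?_⟩
    rw [RingHom.algebraMap_toAlgebra, eval₂_ellipticCubic]
    simp only [evalXY_X, evalXY_C, aeval_X, aeval_C]
    linear_combination h.cube
  obtain ⟨s, hs, hs0⟩ := Submodule.exists_mem_ne_zero_of_ne_bot hI
  have hsint : IsIntegral K[X][X] s := by
    obtain ⟨p, q, r, rfl⟩ := h.evalXY_coords s
    have ha : ∀ p, IsIntegral K[X][X] (evalXY x y p) := fun p => isIntegral_algebraMap (x := p)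
    exact ((ha p).add ((ha q).mul hz)).add ((ha r).mul (hz.pow 2))
  obtain ⟨f, hf, hfs⟩ := hsint
  obtain ⟨i, hi, hiI⟩ := Ideal.exists_coeff_ne_zero_mem_comap_of_root_mem hs0 hs hf.ne_zero hfs
  exact ⟨f.coeff i, hi, hiI⟩

theorem isSimple [CharZero K] [IsDomain S] (hc : c ≠ 0) : P.IsSimple where
  nontrivial := inferInstance
  eq_bot_or_eq_top I hI := by
    refine or_iff_not_imp_left.2 fun h0 => ?_
    obtain ⟨p, hp, hpI⟩ := h.exists_evalXY_mem h0
    rw [← Ideal.radical_eq_top]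
    exact h.eq_top_of_gradient_mem hc hI.radical
      (h.gradient_mem_of_evalXY_mem hI.radical I.radical_isRadical hp (Ideal.le_radical hpI))

end IsEllipticLevel

/-! ### The coordinate ring compared with `K[x][y][z]` modulo the cubic. -/

open Polynomial in
/-- The evaluation `x ↦ x`, `y ↦ y`, `z ↦ z` from `K[x, y, z]` to `K[x][y][z]` modulo the
elliptic cubic. -/
noncomputable def toAdjoinRootEllipticCubic {K : Type*} [Field K] (α c : K) :
    MvPolynomial (Fin 3) K →+* AdjoinRoot (ellipticCubic α c) :=
  MvPolynomial.eval₂Hom (algebraMap K _)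
    ![AdjoinRoot.of (ellipticCubic α c) (C X), AdjoinRoot.of (ellipticCubic α c) X, AdjoinRoot.root (ellipticCubic α c)]

namespace EllipticLevel

open Polynomial

variable {K : Type*} [Field K] [CharZero K] (α c : K)

theorem toAdjoinRoot_sub_eq_zero :
    toAdjoinRootEllipticCubic α c (ellipticCasimir α - MvPolynomial.C c) = 0 := by
  have h := AdjoinRoot.eval₂_root (ellipticCubic α c)
  rw [eval₂_ellipticCubic] at h
  have hC : ∀ k : K, algebraMap K (AdjoinRoot (ellipticCubic α c)) k
    = AdjoinRoot.of (ellipticCubic α c) (C (C k)) := fun k => rfl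
  have h3 : algebraMap K (AdjoinRoot (ellipticCubic α c)) (1 / 3) * 3 = 1 := by
    rw [← map_ofNat (algebraMap K (AdjoinRoot (ellipticCubic α c))) 3, ← map_mul]
    simp
  simp only [toAdjoinRootEllipticCubic, ellipticCasimir, map_sub, map_mul, map_add, map_pow,
    MvPolynomial.coe_eval₂Hom, MvPolynomial.eval₂_C, MvPolynomial.eval₂_X,
    Matrix.cons_val_zero, Matrix.cons_val_one, Matrix.cons_val]
  rw [← hC, ← hC] at h
  set k := algebraMap K (AdjoinRoot (ellipticCubic α c)) (1 / 3)
  set A := algebraMap K (AdjoinRoot (ellipticCubic α c)) α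
  set B := algebraMap K (AdjoinRoot (ellipticCubic α c)) c
  linear_combination k * h + (A * AdjoinRoot.of (ellipticCubic α c) (C X) * AdjoinRoot.of (ellipticCubic α c) X * AdjoinRoot.root (ellipticCubic α c) + B) * h3

/-- The coordinate ring of the level set `C = c` of the elliptic Casimir. -/
abbrev CoordRing : Type _ :=
  MvPolynomial (Fin 3) K ⧸ Ideal.span {ellipticCasimir α - MvPolynomial.C c}

/-- The map from the coordinate ring of the level set to `K[x][y][z]` modulo the elliptic cubic. -/
noncomputable def coordRingHom : CoordRing α c →+* AdjoinRoot (ellipticCubic α c) :=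
  Ideal.Quotient.lift _ (toAdjoinRootEllipticCubic α c) fun a ha => by
    obtain ⟨d, rfl⟩ := Ideal.mem_span_singleton'.1 ha
    rw [map_mul, toAdjoinRoot_sub_eq_zero, mul_zero]

/-- The images of the variables in the coordinate ring of the level set. -/
noncomputable def coord (i : Fin 3) : CoordRing α c :=
  Ideal.Quotient.mk _ (MvPolynomial.X i)

theorem coordRingHom_coord (i : Fin 3) : coordRingHom α c (coord α c i)
    = (![AdjoinRoot.of (ellipticCubic α c) (C X), AdjoinRoot.of (ellipticCubic α c) X, AdjoinRoot.root (ellipticCubic α c)] : Fin 3 → _) i := by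
  simp [coordRingHom, coord, toAdjoinRootEllipticCubic]

theorem coordRingHom_algebraMap (k : K) :
    coordRingHom α c (algebraMap K _ k) = AdjoinRoot.of (ellipticCubic α c) (C (C k)) := by
  change coordRingHom α c (Ideal.Quotient.mk _ (MvPolynomial.C k)) = _
  simp [coordRingHom, toAdjoinRootEllipticCubic]
  rfl

theorem coordRingHom_evalXY (p : K[X][X]) :
    coordRingHom α c (IsEllipticLevel.evalXY (coord α c 0) (coord α c 1) p)
      = AdjoinRoot.of (ellipticCubic α c) p := by
  have h : (coordRingHom α c).comp (IsEllipticLevel.evalXY (coord α c 0) (coord α c 1))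
      = AdjoinRoot.of (ellipticCubic α c) := by
    refine Polynomial.ringHom_ext' (Polynomial.ringHom_ext' (RingHom.ext fun k => ?_) ?_) ?_
    · simp [coordRingHom_algebraMap]
    · simp [coordRingHom_coord]
    · simp [coordRingHom_coord]
  exact congrArg (fun f => f p) h

theorem coord_cube : coord α c 2 ^ 3
    = 3 * algebraMap K _ α * coord α c 0 * coord α c 1 * coord α c 2
      - coord α c 0 ^ 3 - coord α c 1 ^ 3 + 3 * algebraMap K _ c := by
  have h : Ideal.Quotient.mk (Ideal.span {ellipticCasimir α - MvPolynomial.C c})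
      (MvPolynomial.C (1 / 3)
        * (MvPolynomial.X 0 ^ 3 + MvPolynomial.X 1 ^ 3 + MvPolynomial.X 2 ^ 3)
        - MvPolynomial.C α * (MvPolynomial.X 0 * MvPolynomial.X 1 * MvPolynomial.X 2)
        - MvPolynomial.C c) = 0 :=
    Ideal.Quotient.eq_zero_iff_mem.2 (Ideal.mem_span_singleton_self _)
  have hC : ∀ k : K, algebraMap K (CoordRing α c) k
    = Ideal.Quotient.mk _ (MvPolynomial.C k) := fun k => rfl
  have h3 : algebraMap K (CoordRing α c) (1 / 3) * 3 = 1 := by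
    rw [← map_ofNat (algebraMap K (CoordRing α c)) 3, ← map_mul]
    simp
  rw [hC] at h3
  rw [hC, hC]
  simp only [map_sub, map_mul, map_add, map_pow] at h
  simp only [coord]
  linear_combination 3 * h - (Ideal.Quotient.mk _ (MvPolynomial.X 0) ^ 3
    + Ideal.Quotient.mk _ (MvPolynomial.X 1) ^ 3 + Ideal.Quotient.mk _ (MvPolynomial.X 2) ^ 3) * h3

theorem exists_evalXY_coords (s : CoordRing α c) : ∃ p q r : K[X][X],
    s = IsEllipticLevel.evalXY (coord α c 0) (coord α c 1) p
      + IsEllipticLevel.evalXY (coord α c 0) (coord α c 1) q * coord α c 2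
      + IsEllipticLevel.evalXY (coord α c 0) (coord α c 1) r * coord α c 2 ^ 2 := by
  obtain ⟨f, rfl⟩ := Ideal.Quotient.mk_surjective s
  induction f using MvPolynomial.induction_on with
  | C k =>
    refine ⟨C (C k), 0, 0, ?_⟩
    simp only [IsEllipticLevel.evalXY_C, aeval_C, map_zero, zero_mul, add_zero]
    rfl
  | add f g hf hg =>
    obtain ⟨p, q, r, hf⟩ := hf
    obtain ⟨p', q', r', hg⟩ := hg
    refine ⟨p + p', q + q', r + r', ?_⟩
    rw [map_add, hf, hg]
    simp only [map_add]
    ring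
  | mul_X f i hf =>
    obtain ⟨p, q, r, hf⟩ := hf
    rw [map_mul, hf]
    change ∃ p q r, _ * coord α c i = _
    fin_cases i
    · refine ⟨p * C X, q * C X, r * C X, ?_⟩
      simp only [map_mul, IsEllipticLevel.evalXY_C, aeval_X, Fin.zero_eta]
      ring
    · refine ⟨p * X, q * X, r * X, ?_⟩
      simp only [map_mul, IsEllipticLevel.evalXY_X, Fin.mk_one]
      ring
    -- Multiplication by `z` shifts the coordinates, and `rz³` is rewritten by the cubic relation.
    · refine ⟨r * (C (3 * C c - X ^ 3) - X ^ 3), p + r * (C (3 * C α * X) * X), q, ?_⟩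
      simp only [map_mul, map_add, map_sub, map_pow, IsEllipticLevel.evalXY_X,
        IsEllipticLevel.evalXY_C, aeval_X, aeval_C, map_ofNat, Fin.reduceFinMk]
      linear_combination IsEllipticLevel.evalXY (coord α c 0) (coord α c 1) r * coord_cube α c

/-- A polynomial of degree at most 2 in `z` that is divisible by a monic cubic vanishes. This yields
both the freeness of the basis and the injectivity of `coordRingHom`. -/
theorem eq_zero_of_coordRingHom_eq_zero {p q r : K[X][X]}
    (h : coordRingHom α c (IsEllipticLevel.evalXY (coord α c 0) (coord α c 1) p
      + IsEllipticLevel.evalXY (coord α c 0) (coord α c 1) q * coord α c 2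
      + IsEllipticLevel.evalXY (coord α c 0) (coord α c 1) r * coord α c 2 ^ 2) = 0) :
    p = 0 ∧ q = 0 ∧ r = 0 := by
  apply eq_zero_of_ellipticCubic_dvd (α := α) (c := c)
  rw [← AdjoinRoot.mk_eq_zero]
  simp only [map_add, map_mul, map_pow, coordRingHom_evalXY, coordRingHom_coord,
    Matrix.cons_val] at h
  simp only [map_add, map_mul, map_pow, AdjoinRoot.mk_X, AdjoinRoot.mk_C]
  linear_combination h

theorem isDomain_coordRing (hc : c ≠ 0) : IsDomain (CoordRing α c) := by
  have hinj : Function.Injective (coordRingHom α c) := by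
    rw [injective_iff_map_eq_zero]
    intro s hs
    obtain ⟨p, q, r, rfl⟩ := exists_evalXY_coords α c s
    obtain ⟨rfl, rfl, rfl⟩ := eq_zero_of_coordRingHom_eq_zero α c hs
    simp
  have : IsDomain (AdjoinRoot (ellipticCubic α c)) :=
    AdjoinRoot.isDomain_of_prime (ellipticCubic_irreducible hc).prime
  exact hinj.isDomain _

theorem isEllipticLevel : IsEllipticLevel (jacobianPoissonQuotient (ellipticCasimir α) c) α c
    (coord α c 0) (coord α c 1) (coord α c 2) := by
  have hbr : ∀ i j, (jacobianPoissonQuotient (ellipticCasimir α) c).br (coord α c i) (coord α c j)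
    = Ideal.Quotient.mk _ ((jacobianPoisson (ellipticCasimir α)).br
      (MvPolynomial.X i) (MvPolynomial.X j)) := fun i j => rfl
  have hC : ∀ k : K, algebraMap K (CoordRing α c) k
    = Ideal.Quotient.mk _ (MvPolynomial.C k) := fun k => rfl
  have h3 : (MvPolynomial.C 3⁻¹ * 3 : MvPolynomial (Fin 3) K) = 1 := by
    rw [← map_ofNat (MvPolynomial.C (σ := Fin 3) (R := K)) 3, ← map_mul]
    simp
  refine ⟨?_, ?_, ?_, coord_cube α c, exists_evalXY_coords α c, fun p q r h => ?_⟩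
  · rw [hbr, hC, coord, coord, coord, ← map_mul, ← map_mul, ← map_pow, ← map_sub]
    congr 1
    simp [jacobianPoisson, jacobian, Matrix.det_fin_three, ellipticCasimir, MvPolynomial.pderiv_X]
    linear_combination MvPolynomial.X 2 ^ 2 * h3
  · rw [hbr, hC, coord, coord, coord, ← map_mul, ← map_mul, ← map_pow, ← map_sub]
    congr 1
    simp [jacobianPoisson, jacobian, Matrix.det_fin_three, ellipticCasimir, MvPolynomial.pderiv_X]
    linear_combination MvPolynomial.X 0 ^ 2 * h3
  · rw [hbr, hC, coord, coord, coord, ← map_mul, ← map_mul, ← map_pow, ← map_sub]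
    congr 1
    simp [jacobianPoisson, jacobian, Matrix.det_fin_three, ellipticCasimir, MvPolynomial.pderiv_X]
    linear_combination MvPolynomial.X 1 ^ 2 * h3
  · refine eq_zero_of_coordRingHom_eq_zero α c ?_
    exact (congrArg _ h).trans (map_zero _)

end EllipticLevel

theorem corollary2 {K : Type*} [Field K] [CharZero K] (α c : K) (hc : c ≠ 0) :
    (jacobianPoissonQuotient (ellipticCasimir α) c).IsCentral ∧
      (jacobianPoissonQuotient (ellipticCasimir α) c).IsSimple := by
  have := EllipticLevel.isDomain_coordRing α c hc
  exact ⟨(EllipticLevel.isEllipticLevel α c).isCentral,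
    (EllipticLevel.isEllipticLevel α c).isSimple hc⟩
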